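/- Work in a monster model: let $\kappa$ be an uncountable cardinal and $M$ a $\kappa$-saturated structure in an arbitrary first-order language. "Small" means of cardinality $<\kappa$; $A\subseteq B\subseteq M$ denote small sets, $a$ a finite tuple of $M$, $k$ a natural number. A sequence is a family of finite tuples of $M$ of one fixed length, indexed by an infinite linear order. Sequences $I_1,\dots,I_m$ are mutually indiscernible over $A$ if each $I_j$ is indiscernible over $A\cup\bigcup_{i\ne j}I_i$. A partial type $p$ over $A$ has dp-rank $\le k$ if for every realization $c$ of $p$ and any $1+k$ mutually $A$-indiscernible sequences, at least one of them is indiscernible over $Ac$. For a finite family $\mathcal I$ of mutually $A$-indiscernible sequences, we say that $(\mathcal I,a)$ satisfies $S_{k,n}$ (over $A$) if $|\mathcal I|\ge k+n$ and, for every small $B\supseteq A$ over which $\mathcal I$ is still mutually indiscernible, among any $k+n$ sequences of $\mathcal I$ at least $n$ are mutually indiscernible over $Ba$. Then: 1. Suppose $\mathrm{tp}(a/A)$ has dp-rank $\le k$, and let $I_1,\dots,I_m$ ($m>k$) be mutually $B$-indiscernible sequences, where $B\supseteq A$ is small. Then some $m-k$ of them are mutually indiscernible over $Ba$. 2. $\mathrm{tp}(a/A)$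 has dp-rank $\le k$ if and only if $(\mathcal I,c)$ satisfies $S_{k,1}$ for every realization $c$ of $\mathrm{tp}(a/A)$ and every finite family $\mathcal I$ of more than $k$ mutually $A$-indiscernible sequences. 3. If $(\mathcal I,a)$ satisfies $S_{k,1}$ for every finite family $\mathcal I$ of more than $k$ mutually $A$-indiscernible sequences, then for every natural number $n$, $(\mathcal I,a)$ satisfies $S_{k,n}$ for every finite family $\mathcal I$ of at least $k+n$ mutually $A$-indiscernible sequences. 4. Let $\mathcal I$ be a family of $m\ge k+n$ mutually $A$-indiscernible sequences whose index sets are small and have no last element. If $(\mathcal J,a)$ satisfies $S_{k,1}$ for every subfamily $\mathcal J\subseteq\mathcal I$ with $k+1$ members, then $(\mathcal I,a)$ satisfies $S_{k,n}$. -/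

import Mathlib

open FirstOrder Cardinal

universe u v w

namespace DpRank

section

variable (L : FirstOrder.Language.{u, v}) {M : Type w} [L.Structure M]

/-- The complete type `tp(a/A)` of a tuple `a : α → M` over the set `A`: the set of all formulas
with parameters from `A` that `a` satisfies. -/
def tp {α : Type*} (A : Set M) (a : α → M) : Set (L[[A]].Formula α) :=
  {φ | φ.Realize a}

/-- `c` realizes the partial type `p` over `A`. -/
def Realizes {α : Type*} {A : Set M} (c : α → M) (p : Set (L[[A]].Formula α)) : Prop :=
  ∀ φ ∈ p, φ.Realize c

variable (M) in
/-- `M` is `κ`-saturated: every partial type in one variable over a set of fewer than `κ`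
parameters that is finitely satisfiable in `M` is realized in `M`. -/
def IsSaturated (κ : Cardinal.{w}) : Prop :=
  ∀ A : Set M, #A < κ → ∀ p : Set (L[[A]].Formula (Fin 1)),
    (∀ q : Finset (L[[A]].Formula (Fin 1)), (q : Set (L[[A]].Formula (Fin 1))) ⊆ p →
      ∃ x : Fin 1 → M, Realizes L x (q : Set (L[[A]].Formula (Fin 1)))) →
    ∃ x : Fin 1 → M, Realizes L x p

variable (M) in
/-- An infinite sequence of finite tuples (all of the same length `len`) of elements of `M`,
indexed by an infinite linear order. -/
structure TupleSeq where
  /-- the index set -/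
  Idx : Type w
  [linearOrder : LinearOrder Idx]
  [infinite : Infinite Idx]
  /-- the length of the tuples in the sequence -/
  len : ℕ
  /-- the tuples of the sequence -/
  elt : Idx → Fin len → M

attribute [instance] TupleSeq.linearOrder TupleSeq.infinite

/-- The set of all elements of `M` that occur as a coordinate of some tuple of the sequence. -/
def TupleSeq.points (I : TupleSeq M) : Set M :=
  {x | ∃ i j, I.elt i j = x}

/-- The sequence `I` is indiscernible over `A`: any two increasing finite subsequences of the same
length have the same type over `A`. -/
def Indiscernible (A : Set M) (I : TupleSeq M) : Prop :=
  ∀ (n : ℕ) (s t : Fin n ↪o I.Idx),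
    tp L A (fun p : Fin n × Fin I.len => I.elt (s p.1) p.2) =
      tp L A (fun p : Fin n × Fin I.len => I.elt (t p.1) p.2)

/-- The sequences of the family `I` are mutually indiscernible over `A`: each of them is
indiscernible over `A` together with all the other sequences. -/
def MutuallyIndiscernible {ι : Type*} (A : Set M) (I : ι → TupleSeq M) : Prop :=
  ∀ j, Indiscernible L (A ∪ ⋃ i ∈ {i | i ≠ j}, (I i).points) (I j)

/-- The partial type `p` over `A` has dp-rank at most `k`: for every realization `c` of `p` and
every `1 + k` mutually `A`-indiscernible sequences, at least one of the sequences is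
indiscernible over `Ac`. -/
def DpRankLE {α : Type*} {A : Set M} (p : Set (L[[A]].Formula α)) (k : ℕ) : Prop :=
  ∀ c : α → M, Realizes L c p →
    ∀ I : Fin (1 + k) → TupleSeq M, MutuallyIndiscernible L A I →
      ∃ j, Indiscernible L (A ∪ Set.range c) (I j)

/-- The condition `S_{k,n}` for a finite family `I` of sequences (mutually indiscernible over `A`)
and a tuple `a`: the family has at least `k + n` members and, for every small set `B ⊇ A` over
which the whole family is still mutually indiscernible, among any `k + n` of the sequences at
least `n` are mutually indiscernible over `Ba`. (Small means: of cardinality less than `κ`.) -/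
def SCond (κ : Cardinal.{w}) {α ι : Type*} [Fintype ι] (A : Set M) (I : ι → TupleSeq M)
    (a : α → M) (k n : ℕ) : Prop :=
  k + n ≤ Fintype.card ι ∧
    ∀ B : Set M, A ⊆ B → #B < κ → MutuallyIndiscernible L B I →
      ∀ T : Finset ι, T.card = k + n →
        ∃ R ⊆ T, R.card = n ∧
          MutuallyIndiscernible L (B ∪ Set.range a) (fun i : R => I i)

end

end DpRank

/-! Everything rests on passing from one sequence indiscernible over `Ba` to `n` of them mutually
indiscernible over `Ba`. Build the set `R` of good sequences greedily. While `R` has fewer than `n`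
members, `k + 1` of the `k + n` sequences lie outside it. Put all the other sequences, in particular
those in `R`, into the base and apply `S_{k,1}`: some `I_j` is indiscernible over `Ba` together with
the sequences in `R`. This is only half of what is needed, since the sequences in `R` must also
remain mutually indiscernible over `I_j`.

The missing half comes from enlarging `B` beforehand by a countable set `J` built from limits of the
sequences, so that the family is still mutually indiscernible over `BJ`
(`JointlyIndiscernible.exists_containsLimits`). The induction is run over `BJa`. A finite part of
`I_j` can then be replaced by tuples from `J` without changing its type over `Ba`, the sequences in
`R` and any given stage of `J` (`ContainsLimits.exists_replacement`). Indiscernibility of `R` over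
`J` therefore gives indiscernibility over `I_j` (`JointlyIndiscernible.insert_index`).

Limits require sequences without last element, and the base must stay small. Arbitrary index sets
are reduced to order type `ω` by a family of the same type which preserves the finitely many
witnesses of failure (`JointlyIndiscernible.exists_nat_family`).

Dp-rank, defined over `A`, controls every larger base `B` because a failure of indiscernibility uses
finitely many elements of `B`, which can be appended to the tuples of a sequence as constant
coordinates (`DpRankLE.exists_indiscernible`). -/

namespace DpRank

open FirstOrder.Language

/-! ### Partial elementary relations and types -/

section PartialElementary

variable (L : FirstOrder.Language.{u, v}) {N : Type*} {M : Type*} {P : Type*} [L.Structure N]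
  [L.Structure M] [L.Structure P]

/-- A relation between two structures is partially elementary if related tuples satisfy the same
formulas. -/
def PartialElementary (G : Set (N × M)) : Prop :=
  ∀ φ : L.Formula G, φ.Realize (fun g => g.1.1) ↔ φ.Realize (fun g => g.1.2)

variable {L}

theorem PartialElementary.realize_iff {G : Set (N × M)} (hG : PartialElementary L G) {α : Type*}
    (φ : L.Formula α) {x : α → N} {y : α → M} (h : ∀ a, (x a, y a) ∈ G) :
    φ.Realize x ↔ φ.Realize y := by
  have := hG (φ.relabel (fun a => (⟨(x a, y a), h a⟩ : G)))
  rwa [Formula.realize_relabel, Formula.realize_relabel] at this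

theorem PartialElementary.comp {G : Set (N × M)} {H : Set (M × P)} {K : Set (N × P)}
    (hG : PartialElementary L G) (hH : PartialElementary L H)
    (hK : ∀ p ∈ K, ∃ m, (p.1, m) ∈ G ∧ (m, p.2) ∈ H) : PartialElementary L K := by
  intro φ
  choose m h₁ h₂ using fun p : K => hK p p.2
  exact (hG.realize_iff φ h₁).trans (hH.realize_iff φ h₂)

theorem PartialElementary.symm {G : Set (N × M)} {K : Set (M × N)}
    (hG : PartialElementary L G) (hK : ∀ p ∈ K, (p.2, p.1) ∈ G) : PartialElementary L K :=
  fun φ => (hG.realize_iff φ fun p : K => hK p p.2).symm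

/-- The recurring argument "replace, move, replace back": `H` and `H'` trade the tuples on either
side for others between which `G` is already known to preserve formulas. -/
theorem PartialElementary.conj {Q : Type*} [L.Structure Q] {H : Set (P × N)} {G : Set (P × Q)}
    {H' : Set (Q × M)} {K : Set (N × M)} (hH : PartialElementary L H)
    (hG : PartialElementary L G) (hH' : PartialElementary L H')
    (hK : ∀ p ∈ K, ∃ a b, (a, p.1) ∈ H ∧ (a, b) ∈ G ∧ (b, p.2) ∈ H') :
    PartialElementary L K := by
  intro φ
  choose a b h₁ h₂ h₃ using fun p : K => hK p p.2
  exact (hH.realize_iff φ h₁).symm.trans ((hG.realize_iff φ h₂).trans (hH'.realize_iff φ h₃))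

theorem PartialElementary.mono {G K : Set (N × M)} (hG : PartialElementary L G) (hK : K ⊆ G) :
    PartialElementary L K :=
  fun φ => hG.realize_iff φ fun p : K => hK p.2

theorem PartialElementary.of_finite {G : Set (N × M)}
    (h : ∀ F ⊆ G, F.Finite → PartialElementary L F) : PartialElementary L G := by
  classical
  intro φ
  have hF := h (Subtype.val '' (φ.freeVarFinset : Set G)) (by rintro _ ⟨x, -, rfl⟩; exact x.2)
    (φ.freeVarFinset.finite_toSet.image _)
  let f : BoundedFormula.freeVarFinset φ → ↥(Subtype.val '' (φ.freeVarFinset : Set G)) :=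
    fun g => ⟨g.1.1, Set.mem_image_of_mem _ g.2⟩
  have h₁ := BoundedFormula.realize_restrictFreeVar (φ := φ) (f := f)
    (v := fun g => g.1.1) (xs := default) (fun g : G => g.1.1) (fun _ => rfl)
  have h₂ := BoundedFormula.realize_restrictFreeVar (φ := φ) (f := f)
    (v := fun g => g.1.2) (xs := default) (fun g : G => g.1.2) (fun _ => rfl)
  exact h₁.symm.trans ((hF (BoundedFormula.restrictFreeVar φ f)).trans h₂)

theorem PartialElementary.iUnion {G : ℕ → Set (N × M)} (hG : Monotone G)
    (h : ∀ n, PartialElementary L (G n)) : PartialElementary L (⋃ n, G n) := by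
  refine PartialElementary.of_finite fun F hF hfin => ?_
  obtain ⟨n, hn⟩ : ∃ n, F ⊆ G n := by
    induction F, hfin using Set.Finite.induction_on with
    | empty => exact ⟨0, Set.empty_subset _⟩
    | @insert p F _ _ ih =>
      obtain ⟨n, hn⟩ := ih fun x hx => hF (Or.inr hx)
      obtain ⟨m, hm⟩ := Set.mem_iUnion.1 (hF (Set.mem_insert p F))
      exact ⟨max n m, Set.insert_subset (hG (le_max_right n m) hm)
        (hn.trans (hG (le_max_left n m)))⟩
  exact (h n).mono hn

theorem PartialElementary.fst_eq {G : Set (N × M)} (hG : PartialElementary L G) {x y : N} {z : M}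
    (hx : (x, z) ∈ G) (hy : (y, z) ∈ G) : x = y := by
  have := hG.realize_iff (α := Fin 2) ((Term.var 0).equal (Term.var 1)) (x := ![x, y])
    (y := ![z, z]) (by intro a; fin_cases a <;> simpa)
  simpa [Formula.realize_equal] using this

/-- The identity relation on `A`. -/
def diag (A : Set M) : Set (M × M) := {p | p.1 = p.2 ∧ p.1 ∈ A}

theorem mem_diag {A : Set M} {x : M} (h : x ∈ A) : (x, x) ∈ diag A := ⟨rfl, h⟩

theorem diag_mono {A B : Set M} (h : A ⊆ B) : diag A ⊆ diag B := fun _ hp => ⟨hp.1, h hp.2⟩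

variable (L) in
theorem partialElementary_of_subset_diag {G : Set (M × M)} (h : ∀ p ∈ G, p.1 = p.2) :
    PartialElementary L G := by
  intro φ
  rw [show (fun g : G => g.1.1) = fun g : G => g.1.2 from funext fun g => h g g.2]

theorem realize_constantsVarsEquiv_coe {A : Set M} {α : Type*} (φ : L[[A]].Formula α) (x : α → M) :
    Formula.Realize (BoundedFormula.constantsVarsEquiv φ : L.Formula (A ⊕ α))
      (Sum.elim (fun c : A => (c : M)) x) ↔ φ.Realize x :=
  BoundedFormula.realize_constantsVarsEquiv

/-- Parameters are extra variables evaluated at themselves, which is what the diagonal part of the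
relation records. -/
theorem tp_eq_iff {A : Set M} {α : Type*} {x y : α → M} :
    tp L A x = tp L A y ↔
      PartialElementary L (diag A ∪ Set.range fun a => (x a, y a)) := by
  constructor
  · intro h φ
    have hs : ∀ g : ↥(diag A ∪ Set.range fun a => (x a, y a)), ∃ s : A ⊕ α,
        Sum.elim (fun c : A => (c : M)) x s = g.1.1 ∧
          Sum.elim (fun c : A => (c : M)) y s = g.1.2 := by
      rintro ⟨⟨p, q⟩, ⟨h₁, h₂⟩ | ⟨b, hb⟩⟩
      · exact ⟨Sum.inl ⟨p, h₂⟩, rfl, h₁⟩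
      · exact ⟨Sum.inr b, congrArg Prod.fst hb, congrArg Prod.snd hb⟩
    choose s hs₁ hs₂ using hs
    obtain ⟨ψ, hψ⟩ := BoundedFormula.constantsVarsEquiv.surjective (φ.relabel s)
    have key := Set.ext_iff.1 h ψ
    simp only [tp, Set.mem_ofPred_eq] at key
    rw [← realize_constantsVarsEquiv_coe, ← realize_constantsVarsEquiv_coe, hψ,
      Formula.realize_relabel, Formula.realize_relabel] at key
    rwa [show Sum.elim (fun c : A => (c : M)) x ∘ s = _ from funext hs₁,
      show Sum.elim (fun c : A => (c : M)) y ∘ s = _ from funext hs₂] at key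
  · intro h
    ext φ
    simp only [tp, Set.mem_ofPred_eq]
    rw [← realize_constantsVarsEquiv_coe, ← realize_constantsVarsEquiv_coe]
    apply h.realize_iff
    rintro (c | a)
    · exact Or.inl (mem_diag c.2)
    · exact Or.inr ⟨a, rfl⟩

end PartialElementary

/-! ### Extending partial elementary relations by saturation -/

section Saturation

variable {L : FirstOrder.Language.{u, v}} {M : Type w} [L.Structure M]
  {κ : Cardinal.{w}} {N : Type w} [L.Structure N]

theorem IsSaturated.exists_insert (hM : IsSaturated L M κ) {G : Set (N × M)}
    (hG : PartialElementary L G) (hc : #G < κ) (z : N) :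
    ∃ y : M, PartialElementary L (insert (z, y) G) := by
  classical
  have hA : ∀ c : ↥(Prod.snd '' G), ∃ x : N, (x, c.1) ∈ G := by
    rintro ⟨_, ⟨x, y⟩, h, rfl⟩; exact ⟨x, h⟩
  choose f hf using hA
  obtain ⟨x, hx⟩ := hM (Prod.snd '' G) (mk_image_le.trans_lt hc)
    {ψ | Formula.Realize (BoundedFormula.constantsVarsEquiv ψ : L.Formula (_ ⊕ Fin 1))
      (Sum.elim f fun _ => z)} (by
    intro q hq
    let χ : L.Formula (↥(Prod.snd '' G) ⊕ Fin 1) :=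
      Formula.iInf fun ψ : q => (BoundedFormula.constantsVarsEquiv ψ.1 : L.Formula (_ ⊕ Fin 1))
    have h₁ : (χ.iExs (Fin 1)).Realize f :=
      Formula.realize_iExs.2 ⟨fun _ => z, Formula.realize_iInf.2 fun ψ => hq ψ.2⟩
    rw [hG.realize_iff _ hf] at h₁
    obtain ⟨x, hx⟩ := Formula.realize_iExs.1 h₁
    refine ⟨x, fun ψ hψ => ?_⟩
    rw [← realize_constantsVarsEquiv_coe]
    exact Formula.realize_iInf.1 hx ⟨ψ, hψ⟩)
  have key : ∀ φ : L.Formula (↥(Prod.snd '' G) ⊕ Fin 1),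
      φ.Realize (Sum.elim f fun _ => z) ↔
        φ.Realize (Sum.elim (fun c : ↥(Prod.snd '' G) => (c : M)) x) := by
    have : ∀ φ : L.Formula (↥(Prod.snd '' G) ⊕ Fin 1),
      φ.Realize (Sum.elim f fun _ => z) →
        φ.Realize (Sum.elim (fun c : ↥(Prod.snd '' G) => (c : M)) x) := by
      intro φ hφ
      obtain ⟨ψ, rfl⟩ := BoundedFormula.constantsVarsEquiv.surjective φ
      exact (realize_constantsVarsEquiv_coe ψ x).2 (hx ψ hφ)
    -- The realized set is a complete type, so one implication, applied to negations, gives both.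
    refine fun φ => ⟨this φ, fun h => ?_⟩
    by_contra hn
    exact this φ.not hn h
  refine ⟨x 0, fun φ => ?_⟩
  have hs : ∀ g : ↥(insert (z, x 0) G), ∃ s : ↥(Prod.snd '' G) ⊕ Fin 1,
      Sum.elim f (fun _ => z) s = g.1.1 ∧
        Sum.elim (fun c : ↥(Prod.snd '' G) => (c : M)) x s = g.1.2 := by
    rintro ⟨⟨p, q⟩, h | h⟩
    · obtain ⟨rfl, rfl⟩ := Prod.mk.inj h
      exact ⟨Sum.inr 0, rfl, rfl⟩
    · exact ⟨Sum.inl ⟨q, _, h, rfl⟩, hG.fst_eq (hf _) h, rfl⟩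
  choose s hs₁ hs₂ using hs
  have := key (φ.relabel s)
  rw [Formula.realize_relabel, Formula.realize_relabel] at this
  rwa [show (Sum.elim f fun _ => z) ∘ s = _ from funext hs₁,
    show Sum.elim (fun c : ↥(Prod.snd '' G) => (c : M)) x ∘ s = _ from funext hs₂] at this

theorem IsSaturated.exists_union_range (hM : IsSaturated L M κ) (hκ : ℵ₀ ≤ κ)
    {β : Type*} [Finite β] {G : Set (N × M)}
    (hG : PartialElementary L G) (hc : #G < κ) (z : β → N) :
    ∃ y : β → M, PartialElementary L (G ∪ Set.range fun b => (z b, y b)) := by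
  have key : ∀ s : Set β, s.Finite →
      ∃ y : β → M, PartialElementary L (G ∪ (fun b => (z b, y b)) '' s) ∧
        #↥(G ∪ (fun b => (z b, y b)) '' s) < κ := by
    intro s hs
    induction s, hs using Set.Finite.induction_on with
    | empty =>
      by_cases hβ : Nonempty (β → M)
      · exact ⟨hβ.some, by simpa using hG, by simpa using hc⟩
      -- The induction needs some function `β → M` to start from; if there is none, one application
      -- of saturation shows that `β` is empty, a contradiction.
      · have : IsEmpty M := by
          by_contra h
          rw [not_isEmpty_iff] at h
          exact hβ ⟨fun _ => h.some⟩
        have hb : IsEmpty β := by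
          by_contra h
          rw [not_isEmpty_iff] at h
          exact this.false (hM.exists_insert hG hc (z h.some)).choose
        exact (hβ ⟨hb.elim⟩).elim
    | @insert b s hb _ ih =>
      classical
      obtain ⟨y, hy, hc'⟩ := ih
      obtain ⟨m, hm⟩ := hM.exists_insert hy hc' (z b)
      have : G ∪ (fun c => (z c, Function.update y b m c)) '' insert b s ⊆
          insert (z b, m) (G ∪ (fun b => (z b, y b)) '' s) := by
        rintro p (hp | ⟨c, rfl | hc, rfl⟩)
        · exact Or.inr (Or.inl hp)
        · left; simp
        · have : c ≠ b := fun h => hb (h ▸ hc)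
          exact Or.inr (Or.inr ⟨c, hc, by simp [Function.update_of_ne this]⟩)
      refine ⟨Function.update y b m, hm.mono this, (mk_le_mk_of_subset this).trans_lt ?_⟩
      exact (mk_insert_le).trans_lt (add_lt_of_lt hκ hc' (one_lt_aleph0.trans_le hκ))
  obtain ⟨y, hy, -⟩ := key Set.univ Set.finite_univ
  exact ⟨y, by simpa using hy⟩

end Saturation

end DpRank

/-! ### Joint indiscernibility through order relations on the indices -/

namespace DpRank

open FirstOrder.Language

section OrderRel

variable {X : Type*} [LinearOrder X]

/-- A relation on a linear order that is the graph of a strictly monotone partial map. -/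
def OrderRel (ρ : Set (X × X)) : Prop :=
  ∀ p ∈ ρ, ∀ q ∈ ρ, (p.1 < q.1 ↔ p.2 < q.2)

theorem OrderRel.mono {ρ σ : Set (X × X)} (h : OrderRel ρ) (hσ : σ ⊆ ρ) : OrderRel σ :=
  fun p hp q hq => h p (hσ hp) q (hσ hq)

theorem OrderRel.snd_eq {ρ : Set (X × X)} (h : OrderRel ρ) {x y z : X} (hy : (x, y) ∈ ρ)
    (hz : (x, z) ∈ ρ) : y = z :=
  le_antisymm (not_lt.1 fun hl => lt_irrefl x ((h _ hz _ hy).2 hl))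
    (not_lt.1 fun hl => lt_irrefl x ((h _ hy _ hz).2 hl))

theorem orderRel_of_eq {ρ : Set (X × X)} (h : ∀ p ∈ ρ, p.1 = p.2) : OrderRel ρ := by
  intro p hp q hq
  rw [h p hp, h q hq]

theorem OrderRel.insert {ρ : Set (X × X)} (h : OrderRel ρ) {t : X}
    (ht : ∀ p ∈ ρ, p.1 < t ∧ p.2 < t) : OrderRel (insert (t, t) ρ) := by
  rintro p (rfl | hp) q (rfl | hq)
  · exact Iff.rfl
  · exact iff_of_false (ht q hq).1.not_gt (ht q hq).2.not_gt
  · exact iff_of_true (ht p hp).1 (ht p hp).2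
  · exact h p hp q hq

end OrderRel

variable {L : FirstOrder.Language.{u, v}} {M : Type w} [L.Structure M]

/-- The pairs of elements at corresponding places of related tuples of the sequence. -/
def TupleSeq.pairs (I : TupleSeq M) (ρ : Set (I.Idx × I.Idx)) : Set (M × M) :=
  {p | ∃ z ∈ ρ, ∃ q, p = (I.elt z.1 q, I.elt z.2 q)}

section Family

variable {ι : Type*}

/-- The union of the sets `TupleSeq.pairs` over the sequences with index in `R`. -/
def familyPairs (I : ι → TupleSeq M) (R : Set ι) (ρ : ∀ i, Set ((I i).Idx × (I i).Idx)) :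
    Set (M × M) :=
  {p | ∃ i ∈ R, p ∈ (I i).pairs (ρ i)}

/-- The elements occurring in the sequences with index in `R`. -/
def familyPoints (I : ι → TupleSeq M) (R : Set ι) : Set M :=
  {x | ∃ i ∈ R, x ∈ (I i).points}

theorem familyPoints_mono (I : ι → TupleSeq M) {R S : Set ι} (h : R ⊆ S) :
    familyPoints I R ⊆ familyPoints I S :=
  fun _ ⟨i, hi, hx⟩ => ⟨i, h hi, hx⟩

theorem elt_mem_familyPoints (I : ι → TupleSeq M) {R : Set ι} {i : ι} (hi : i ∈ R) (x : (I i).Idx)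
    (q : Fin (I i).len) : (I i).elt x q ∈ familyPoints I R :=
  ⟨i, hi, x, q, rfl⟩

theorem exists_finite_familyPairs (I : ι → TupleSeq M) (R : Set ι)
    (ρ : ∀ i, Set ((I i).Idx × (I i).Idx)) {D F : Set (M × M)} (hF : F.Finite)
    (h : F ⊆ D ∪ familyPairs I R ρ) :
    ∃ σ : ∀ i, Set ((I i).Idx × (I i).Idx), (∀ i, σ i ⊆ ρ i) ∧ (∀ i, (σ i).Finite) ∧
      F ⊆ D ∪ familyPairs I R σ := by
  classical
  induction F, hF using Set.Finite.induction_on with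
  | empty => exact ⟨fun _ => ∅, fun _ => Set.empty_subset _, fun _ => Set.finite_empty,
      Set.empty_subset _⟩
  | @insert p F _ _ ih =>
    obtain ⟨σ, h₁, h₂, h₃⟩ := ih fun x hx => h (Or.inr hx)
    obtain hp | ⟨i, hi, z, hz, q, rfl⟩ := h (Set.mem_insert p F)
    · exact ⟨σ, h₁, h₂, Set.insert_subset (Or.inl hp) h₃⟩
    · refine ⟨Function.update σ i (insert z (σ i)), fun j => ?_, fun j => ?_,
        Set.insert_subset (Or.inr ⟨i, hi, z, by simp, q, rfl⟩) fun x hx => ?_⟩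
      · obtain rfl | hj := eq_or_ne j i
        · simpa using Set.insert_subset hz (h₁ j)
        · simpa [Function.update_of_ne hj] using h₁ j
      · obtain rfl | hj := eq_or_ne j i
        · simpa using (h₂ j).insert z
        · simpa [Function.update_of_ne hj] using h₂ j
      · obtain hx | ⟨j, hj, z', hz', q', rfl⟩ := h₃ hx
        · exact Or.inl hx
        · refine Or.inr ⟨j, hj, z', ?_, q', rfl⟩
          obtain rfl | hji := eq_or_ne j i
          · simpa using Or.inr hz'
          · simpa [Function.update_of_ne hji] using hz'

variable (L) in
/-- The sequences with index in `R` are jointly indiscernible over `A`: applying an order relation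
to the indices of each of them yields a partially elementary relation over `A`. -/
def JointlyIndiscernible (A : Set M) (I : ι → TupleSeq M) (R : Set ι) : Prop :=
  ∀ ρ : ∀ i, Set ((I i).Idx × (I i).Idx), (∀ i, OrderRel (ρ i)) →
    PartialElementary L (diag A ∪ familyPairs I R ρ)

theorem jointlyIndiscernible_of_finite {A : Set M} {I : ι → TupleSeq M} {R : Set ι}
    (h : ∀ ρ : ∀ i, Set ((I i).Idx × (I i).Idx), (∀ i, OrderRel (ρ i)) → (∀ i, (ρ i).Finite) →
      PartialElementary L (diag A ∪ familyPairs I R ρ)) : JointlyIndiscernible L A I R := by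
  intro ρ hρ
  refine PartialElementary.of_finite fun F hF hfin => ?_
  obtain ⟨σ, h₁, h₂, h₃⟩ := exists_finite_familyPairs I R ρ hfin hF
  exact (h σ (fun i => (hρ i).mono (h₁ i)) h₂).mono h₃

/-- Keeping the indices outside `S` fixed turns the points of those sequences into parameters. -/
theorem JointlyIndiscernible.subfamily {A C : Set M} {I : ι → TupleSeq M} {R S : Set ι}
    (h : JointlyIndiscernible L A I R) (hS : S ⊆ R)
    (hC : C ⊆ A ∪ familyPoints I (R \ S)) : JointlyIndiscernible L C I S := by
  classical
  intro ρ hρ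
  refine (h (fun i => if i ∈ S then ρ i else {p | p.1 = p.2}) fun i => ?_).mono ?_
  · split_ifs
    · exact hρ i
    · exact orderRel_of_eq fun p hp => hp
  · rintro ⟨x, y⟩ (⟨hxy, hx⟩ | ⟨i, hi, z, hz, q, hq⟩)
    · obtain rfl : x = y := hxy
      obtain hx | ⟨i, hi, z, q, hq⟩ := hC hx
      · exact Or.inl (mem_diag hx)
      · exact Or.inr ⟨i, hi.1, (z, z), by beta_reduce; rw [if_neg hi.2]; rfl, q, by rw [hq]⟩
    · exact Or.inr ⟨i, hS hi, z, by beta_reduce; rwa [if_pos hi], q, hq⟩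

theorem indiscernible_iff {A : Set M} {I : TupleSeq M} :
    Indiscernible L A I ↔ ∀ ρ, OrderRel ρ → PartialElementary L (diag A ∪ I.pairs ρ) := by
  constructor
  · intro h ρ hρ
    refine PartialElementary.of_finite fun F hF hfin => ?_
    obtain ⟨σ, h₁, h₂, h₃⟩ := exists_finite_familyPairs (fun _ : Unit => I) Set.univ (fun _ => ρ)
      (D := diag A) hfin fun p hp => (hF hp).imp id fun hp => ⟨(), trivial, hp⟩
    have hσ := hρ.mono (h₁ ())
    let X := ((h₂ ()).image Prod.fst).toFinset
    have hX : ∀ x ∈ X, ∃ y, (x, y) ∈ σ () := by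
      intro x hx
      obtain ⟨⟨x, y⟩, hz, rfl⟩ := (Set.Finite.mem_toFinset _).1 hx
      exact ⟨y, hz⟩
    choose g hg using hX
    let s : Fin X.card ↪o I.Idx := X.orderEmbOfFin rfl
    have hs : ∀ p, s p ∈ X := fun p => X.orderEmbOfFin_mem rfl p
    let t : Fin X.card ↪o I.Idx := OrderEmbedding.ofStrictMono (fun p => g (s p) (hs p))
      fun p q hpq => (hσ _ (hg _ (hs p)) _ (hg _ (hs q))).1 (s.lt_iff_lt.2 hpq)
    refine (tp_eq_iff.1 (h _ s t)).mono fun p hp => ?_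
    obtain hp | ⟨⟨⟩, -, ⟨x, y⟩, hz, q, rfl⟩ := h₃ hp
    · exact Or.inl hp
    · have hx : x ∈ X := (Set.Finite.mem_toFinset _).2 ⟨_, hz, rfl⟩
      obtain ⟨p, hp⟩ : x ∈ Set.range s := by
        rw [Finset.range_orderEmbOfFin]; exact hx
      refine Or.inr ⟨(p, q), ?_⟩
      have : t p = y := (hσ.mono subset_rfl).snd_eq (x := x) (by
        rw [← hp]; exact hg _ (hs p)) hz
      simp only [this, hp]
  · intro h n s t
    refine tp_eq_iff.2 ((h {z | ∃ p, z = (s p, t p)} ?_).mono ?_)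
    · rintro _ ⟨p, rfl⟩ _ ⟨q, rfl⟩
      simp
    · rintro _ (hp | ⟨⟨p, q⟩, rfl⟩)
      · exact Or.inl hp
      · exact Or.inr ⟨_, ⟨p, rfl⟩, q, rfl⟩

theorem Indiscernible.mono {A B : Set M} {I : TupleSeq M} (h : Indiscernible L B I) (hAB : A ⊆ B) :
    Indiscernible L A I :=
  indiscernible_iff.2 fun ρ hρ =>
    (indiscernible_iff.1 h ρ hρ).mono (Set.union_subset_union_left _ (diag_mono hAB))

theorem jointlyIndiscernible_singleton {A : Set M} {I : ι → TupleSeq M} {j : ι} :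
    JointlyIndiscernible L A I {j} ↔ Indiscernible L A (I j) := by
  classical
  rw [indiscernible_iff]
  constructor
  · intro h ρ hρ
    refine (h (Function.update (fun _ => ∅) j ρ) fun i => ?_).mono ?_
    · obtain rfl | hi := eq_or_ne i j
      · simpa using hρ
      · rw [Function.update_of_ne hi]
        exact fun p hp => hp.elim
    · exact Set.union_subset_union_right _ fun p hp => ⟨j, rfl, by simpa using hp⟩
  · intro h ρ hρ
    refine (h (ρ j) (hρ j)).mono (Set.union_subset_union_right _ ?_)
    rintro p ⟨i, rfl, hp⟩
    exact hp

/-- The sequences can be moved one at a time: while one moves, the points of the others belong to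
its base. -/
theorem jointlyIndiscernible_iff {A : Set M} {I : ι → TupleSeq M} {R : Set ι} (hR : R.Finite) :
    JointlyIndiscernible L A I R ↔
      ∀ j ∈ R, Indiscernible L (A ∪ familyPoints I (R \ {j})) (I j) := by
  classical
  refine ⟨fun h j hj => jointlyIndiscernible_singleton.1
    (h.subfamily (Set.singleton_subset_iff.2 hj) subset_rfl), fun h ρ hρ => ?_⟩
  have key : ∀ U : Set ι, U.Finite → U ⊆ R →
      PartialElementary L (diag A ∪
        familyPairs I R fun i => if i ∈ U then ρ i else {p | p.1 = p.2}) := by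
    intro U hU
    induction U, hU using Set.Finite.induction_on with
    | empty =>
      refine fun _ => partialElementary_of_subset_diag L ?_
      rintro p (hp | ⟨i, -, z, hz, q, rfl⟩)
      · exact hp.1
      · beta_reduce at hz; rw [if_neg (Set.notMem_empty i)] at hz
        exact congrArg (fun x => (I i).elt x q) hz
    | @insert j U hj _ ih =>
      intro hU
      refine (indiscernible_iff.1 (h j (hU (Set.mem_insert j U))) (ρ j) (hρ j)).comp
        (ih fun x hx => hU (Or.inr hx)) ?_
      rintro p (hp | ⟨i, hi, z, hz, q, rfl⟩)
      · exact ⟨p.1, Or.inl (mem_diag (Or.inl hp.2)), Or.inl hp⟩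
      · obtain rfl | hij := eq_or_ne i j
        · refine ⟨(I i).elt z.2 q, Or.inr ⟨z, by simpa using hz, q, rfl⟩,
            Or.inr ⟨i, hi, (z.2, z.2), ?_, q, rfl⟩⟩
          beta_reduce; rw [if_neg hj]; rfl
        · refine ⟨(I i).elt z.1 q,
            Or.inl (mem_diag (Or.inr (elt_mem_familyPoints I (R := R \ {j}) ⟨hi, hij⟩ _ _))),
            Or.inr ⟨i, hi, z, ?_, q, rfl⟩⟩
          simpa [hij] using hz
  refine (key R hR subset_rfl).mono (Set.union_subset_union_right _ ?_)
  rintro p ⟨i, hi, hp⟩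
  exact ⟨i, hi, by beta_reduce; rwa [if_pos hi]⟩

theorem mutuallyIndiscernible_iff [Finite ι] {A : Set M} {I : ι → TupleSeq M} :
    MutuallyIndiscernible L A I ↔ JointlyIndiscernible L A I Set.univ := by
  rw [jointlyIndiscernible_iff Set.finite_univ]
  have (j : ι) : (⋃ i ∈ {i | i ≠ j}, (I i).points) = familyPoints I (Set.univ \ {j}) := by
    ext x; simp [familyPoints]
  simp only [MutuallyIndiscernible, this, Set.mem_univ, true_imp_iff]

theorem mutuallyIndiscernible_coe_iff {A : Set M} {I : ι → TupleSeq M} {R : Finset ι} :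
    MutuallyIndiscernible L A (fun i : R => I i) ↔ JointlyIndiscernible L A I (R : Set ι) := by
  rw [jointlyIndiscernible_iff R.finite_toSet]
  have (j : R) : (⋃ i ∈ {i : R | i ≠ j}, (I i).points) = familyPoints I ((R : Set ι) \ {j.1}) := by
    ext x
    simp only [Set.mem_iUnion, familyPoints, Set.mem_ofPred_eq]
    exact ⟨fun ⟨i, hi, hx⟩ => ⟨i, ⟨i.2, fun h => hi (Subtype.ext h)⟩, hx⟩,
      fun ⟨i, hi, hx⟩ => ⟨⟨i, hi.1⟩, fun h => hi.2 (congrArg Subtype.val h), hx⟩⟩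
  simp only [MutuallyIndiscernible, this, Subtype.forall, Finset.mem_coe]

end Family

end DpRank

/-! ### Replacing a family by sequences of order type `ω` -/

namespace DpRank

open FirstOrder.Language

theorem exists_strictMonoOn_Iio {X : Type*} [LinearOrder X] [Infinite X] (F : Finset X) {n : ℕ}
    (hn : F.card ≤ n) : ∃ s : ℕ → X, StrictMonoOn s (Set.Iio n) ∧ ∀ x ∈ F, ∃ l < n, s l = x := by
  obtain ⟨t, hFt, ht⟩ := Infinite.exists_superset_card_eq F n hn
  have x₀ : X := Classical.arbitrary X
  refine ⟨fun l => if h : l < n then t.orderEmbOfFin ht ⟨l, h⟩ else x₀, ?_, fun x hx => ?_⟩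
  · intro l hl m hm hlm
    rw [Set.mem_Iio] at hl hm
    simpa [hl, hm] using hlm
  · obtain ⟨l, hl⟩ : x ∈ Set.range (t.orderEmbOfFin ht) := by
      rw [Finset.range_orderEmbOfFin]; exact hFt hx
    exact ⟨l, l.2, by simpa using hl⟩

variable {L : FirstOrder.Language.{u, v}} {M : Type w} [L.Structure M] {κ : Cardinal.{w}}
  {ι : Type*}

/-- The pairs of elements at corresponding places of the initial segments of length `n` of the
subsequences of `I` given by `s` and of the sequences `e`. -/
def prefixPairs (I : ι → TupleSeq M) (s : ∀ i, ℕ → (I i).Idx)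
    (e : ∀ i, ℕ → Fin (I i).len → M) (n : ℕ) : Set (M × M) :=
  {p | ∃ i, ∃ l < n, ∃ q, p = ((I i).elt (s i l) q, e i l q)}

theorem prefixPairs_finite [Finite ι] (I : ι → TupleSeq M) (s : ∀ i, ℕ → (I i).Idx)
    (e : ∀ i, ℕ → Fin (I i).len → M) (n : ℕ) : (prefixPairs I s e n).Finite := by
  refine (Set.finite_range fun x : Σ i, Fin n × Fin (I i).len =>
    ((I x.1).elt (s x.1 x.2.1) x.2.2, e x.1 x.2.1 x.2.2)).subset ?_
  rintro _ ⟨i, l, hl, q, rfl⟩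
  exact ⟨⟨i, ⟨l, hl⟩, q⟩, rfl⟩

variable (L) in
/-- The first `n` tuples of the sequences `e` have the same type over `B` as the increasing
`n`-tuples from the sequences of the family `I`. -/
def PrefixType (B : Set M) (I : ι → TupleSeq M) (n : ℕ) (e : ∀ i, ℕ → Fin (I i).len → M) : Prop :=
  ∀ s : ∀ i, ℕ → (I i).Idx, (∀ i, StrictMonoOn (s i) (Set.Iio n)) →
    PartialElementary L (diag B ∪ prefixPairs I s e n)

/-- By joint indiscernibility, any two choices of increasing tuples have the same type over `B`, so
one choice is enough. -/
theorem JointlyIndiscernible.prefixType {B : Set M} {I : ι → TupleSeq M}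
    (hI : JointlyIndiscernible L B I Set.univ) {n : ℕ} {e : ∀ i, ℕ → Fin (I i).len → M}
    {s : ∀ i, ℕ → (I i).Idx} (hs : ∀ i, StrictMonoOn (s i) (Set.Iio n))
    (h : PartialElementary L (diag B ∪ prefixPairs I s e n)) : PrefixType L B I n e := by
  intro t ht
  refine (hI (fun i => {p | ∃ l < n, p = (t i l, s i l)}) fun i => ?_).comp h ?_
  · rintro _ ⟨l, hl, rfl⟩ _ ⟨m, hm, rfl⟩
    exact ((ht i).lt_iff_lt hl hm).trans ((hs i).lt_iff_lt hl hm).symm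
  · rintro p (hp | ⟨i, l, hl, q, rfl⟩)
    · exact ⟨p.1, Or.inl (mem_diag hp.2), Or.inl hp⟩
    · exact ⟨_, Or.inr ⟨i, trivial, _, ⟨l, hl, rfl⟩, q, rfl⟩, Or.inr ⟨i, l, hl, q, rfl⟩⟩

theorem JointlyIndiscernible.exists_prefixType_succ [Finite ι] (hM : IsSaturated L M κ)
    (hκ : ℵ₀ < κ) {B : Set M} (hB : #B < κ) {I : ι → TupleSeq M}
    (hI : JointlyIndiscernible L B I Set.univ) {n : ℕ} {e : ∀ i, ℕ → Fin (I i).len → M}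
    (h : PrefixType L B I n e) :
    ∃ e' : ∀ i, ℕ → Fin (I i).len → M, PrefixType L B I (n + 1) e' ∧
      ∀ i, ∀ l < n, e' i l = e i l := by
  choose s hs _ using fun i => exists_strictMonoOn_Iio (∅ : Finset (I i).Idx) (Nat.zero_le (n + 1))
  have hPE := h s fun i => (hs i).mono (Set.Iio_subset_Iio n.le_succ)
  have hcard : #↥(diag B ∪ prefixPairs I s e n) < κ := by
    refine (mk_union_le _ _).trans_lt (add_lt_of_lt hκ.le ?_ ?_)
    · refine lt_of_le_of_lt ?_ hB
      refine mk_le_of_injective (f := fun p : diag B => (⟨p.1.1, p.2.2⟩ : B)) ?_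
      rintro ⟨⟨a, b⟩, h₁, h₂⟩ ⟨⟨c, d⟩, h₃, h₄⟩ h₅
      simp only [Subtype.mk.injEq] at h₁ h₃ h₅
      subst h₁ h₃ h₅
      rfl
    · have := (prefixPairs_finite I s e n).to_subtype
      exact (mk_lt_aleph0).trans hκ
  obtain ⟨y, hy⟩ := hM.exists_union_range hκ.le hPE hcard
    fun x : Σ i, Fin (I i).len => (I x.1).elt (s x.1 n) x.2
  refine ⟨fun i => Function.update (e i) n fun q => y ⟨i, q⟩, hI.prefixType hs (hy.mono ?_),
    fun i l hl => by simp [hl.ne]⟩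
  rintro p (hp | ⟨i, l, hl, q, rfl⟩)
  · exact Or.inl (Or.inl hp)
  · obtain hl | rfl := Nat.lt_succ_iff_lt_or_eq.1 hl
    · exact Or.inl (Or.inr ⟨i, l, hl, q, by simp [hl.ne]⟩)
    · exact Or.inr ⟨⟨i, q⟩, by simp⟩

theorem JointlyIndiscernible.exists_forall_prefixType [Finite ι] (hM : IsSaturated L M κ)
    (hκ : ℵ₀ < κ) {B : Set M} (hB : #B < κ) {I : ι → TupleSeq M}
    (hI : JointlyIndiscernible L B I Set.univ) {N : ℕ} {e₀ : ∀ i, ℕ → Fin (I i).len → M}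
    (h₀ : PrefixType L B I N e₀) :
    ∃ e : ∀ i, ℕ → Fin (I i).len → M, (∀ n, PrefixType L B I (N + n) e) ∧
      ∀ i, ∀ l < N, e i l = e₀ i l := by
  have step : ∀ n (e : {e // PrefixType L B I (N + n) e}),
      ∃ e' : {e // PrefixType L B I (N + (n + 1)) e}, ∀ i, ∀ l < N + n, e'.1 i l = e.1 i l := by
    rintro n ⟨e, he⟩
    obtain ⟨e', h₁, h₂⟩ := hI.exists_prefixType_succ hM hκ hB he
    exact ⟨⟨e', h₁⟩, h₂⟩
  choose g hg using step
  let f : ∀ n, {e // PrefixType L B I (N + n) e} := fun n => Nat.rec ⟨e₀, h₀⟩ g n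
  have hf : ∀ m n, m ≤ n → ∀ i, ∀ l < N + m, (f n).1 i l = (f m).1 i l := by
    intro m n hmn
    induction n, hmn using Nat.le_induction with
    | base => exact fun _ _ _ => rfl
    | succ n hmn ih =>
      intro i l hl
      exact (hg n (f n) i l (by omega)).trans (ih i l hl)
  -- Entry `l` no longer changes from stage `l + 1` on, so the limit family can be read off the
  -- diagonal.
  have hlim : ∀ n i, ∀ l < N + n, (f (l + 1)).1 i l = (f n).1 i l := by
    intro n i l hl
    obtain h | h := le_total (l + 1) n
    · exact (hf _ _ h i l (by omega)).symm
    · exact hf _ _ h i l hl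
  refine ⟨fun i l => (f (l + 1)).1 i l, fun n s hs => ((f n).2 s hs).mono
    (Set.union_subset_union_right _ ?_), fun i l hl => hlim 0 i l hl⟩
  rintro _ ⟨i, l, hl, q, rfl⟩
  exact ⟨i, l, hl, q, by beta_reduce; rw [hlim n i l hl]⟩

/-- A finite family of jointly indiscernible sequences can be replaced by a family of sequences
of order type `ω` that is no less indiscernible over a given set. -/
theorem JointlyIndiscernible.exists_nat_family [Finite ι] (hM : IsSaturated L M κ)
    (hκ : ℵ₀ < κ) {B : Set M} (hB : #B < κ) {I : ι → TupleSeq M}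
    (hI : JointlyIndiscernible L B I Set.univ) (C : Set M) :
    ∃ I' : ι → TupleSeq M, (∀ i, NoMaxOrder (I' i).Idx) ∧ (∀ i, #(I' i).Idx < κ) ∧
      JointlyIndiscernible L B I' Set.univ ∧
      ∀ R : Set ι, JointlyIndiscernible L C I' R → JointlyIndiscernible L C I R := by
  classical
  -- For each `R`, one finite relation decides joint indiscernibility over `C`. There are finitely
  -- many `R`, so finitely many indices `F` occur; the new sequences start with the actual tuples at
  -- these indices.
  have hbad : ∀ R : Set ι, ∃ ρ : ∀ i, Set ((I i).Idx × (I i).Idx), (∀ i, OrderRel (ρ i)) ∧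
      (∀ i, (ρ i).Finite) ∧
      (PartialElementary L (diag C ∪ familyPairs I R ρ) → JointlyIndiscernible L C I R) := by
    intro R
    by_contra! h
    obtain ⟨-, hn⟩ := h (fun _ => ∅) (fun _ _ h => h.elim) fun _ => Set.finite_empty
    exact hn (jointlyIndiscernible_of_finite fun ρ hρ hfin => (h ρ hρ hfin).1)
  choose ρ hρ hfin hR using hbad
  have hF : ∀ i, (⋃ R, (Prod.fst '' ρ R i ∪ Prod.snd '' ρ R i)).Finite := fun i =>
    Set.finite_iUnion fun R => ((hfin R i).image _).union ((hfin R i).image _)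
  obtain ⟨N, hN⟩ := (Set.finite_range fun i => (hF i).toFinset.card).bddAbove
  choose s hs hsF using fun i => exists_strictMonoOn_Iio (hF i).toFinset (hN ⟨i, rfl⟩)
  have h₀ : PrefixType L B I N fun i l => (I i).elt (s i l) := by
    refine hI.prefixType hs (partialElementary_of_subset_diag L ?_)
    rintro p (hp | ⟨i, l, -, q, rfl⟩)
    · exact hp.1
    · rfl
  obtain ⟨e, he, heN⟩ := hI.exists_forall_prefixType hM hκ hB h₀
  refine ⟨fun i => { Idx := ULift ℕ, len := (I i).len, elt := fun l => e i l.down },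
    fun i => ⟨fun l : ULift ℕ => ⟨⟨l.down + 1⟩, Nat.lt_succ_self l.down⟩⟩, fun i => by simpa using hκ, ?_,
    fun R hI' => hR R ((hI' (fun i => {z | z.1.down < N ∧ z.2.down < N ∧
      (s i z.1.down, s i z.2.down) ∈ ρ R i}) fun i => ?_).mono
        (Set.union_subset_union_right _ ?_))⟩
  -- A finite relation lives on an initial segment, which has the type of increasing tuples of `I`;
  -- the claim is transported from `I`.
  · refine jointlyIndiscernible_of_finite fun σ hσ hσfin => ?_
    obtain ⟨n, hn⟩ := (Set.finite_iUnion fun i =>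
      (hσfin i).image fun z => max z.1.down z.2.down).bddAbove
    have hn' : ∀ i, ∀ z ∈ σ i, z.1.down < N + (n + 1) ∧ z.2.down < N + (n + 1) := by
      intro i z hz
      have := hn (Set.mem_iUnion.2 ⟨i, z, hz, rfl⟩)
      simp only [sup_le_iff] at this
      omega
    choose t ht _ using fun i =>
      exists_strictMonoOn_Iio (∅ : Finset (I i).Idx) (Nat.zero_le (N + (n + 1)))
    have h₁ := he (n + 1) t ht
    have h₂ := hI (fun i => {p | ∃ z ∈ σ i, p = (t i z.1.down, t i z.2.down)}) fun i => by
      rintro _ ⟨z, hz, rfl⟩ _ ⟨y, hy, rfl⟩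
      exact ((ht i).lt_iff_lt (hn' i z hz).1 (hn' i y hy).1).trans
        ((hσ i z hz y hy).trans ((ht i).lt_iff_lt (hn' i z hz).2 (hn' i y hy).2).symm)
    refine h₁.conj h₂ h₁ ?_
    rintro p (hp | ⟨i, -, z, hz, q, rfl⟩)
    · exact ⟨p.1, p.1, Or.inl (mem_diag hp.2), Or.inl (mem_diag hp.2), Or.inl hp⟩
    · exact ⟨_, _, Or.inr ⟨i, _, (hn' i z hz).1, q, rfl⟩,
        Or.inr ⟨i, trivial, _, ⟨z, hz, rfl⟩, q, rfl⟩, Or.inr ⟨i, _, (hn' i z hz).2, q, rfl⟩⟩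
  · rintro z ⟨hz₁, hz₂, hz⟩ y ⟨hy₁, hy₂, hy⟩
    exact ((hs i).lt_iff_lt hz₁ hy₁).symm.trans
      ((hρ R i _ hz _ hy).trans ((hs i).lt_iff_lt hz₂ hy₂))
  · rintro _ ⟨i, hi, ⟨x, y⟩, hz, q, rfl⟩
    obtain ⟨l, hl, rfl⟩ := hsF i x
      ((Set.Finite.mem_toFinset _).2 (Set.mem_iUnion.2 ⟨R, Or.inl ⟨_, hz, rfl⟩⟩))
    obtain ⟨m, hm, rfl⟩ := hsF i y
      ((Set.Finite.mem_toFinset _).2 (Set.mem_iUnion.2 ⟨R, Or.inr ⟨_, hz, rfl⟩⟩))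
    exact ⟨i, hi, (⟨l⟩, ⟨m⟩), ⟨hl, hm, hz⟩, q, by simp only [heN i l hl, heN i m hm]⟩

end DpRank

/-! ### Limits of sequences -/

namespace DpRank

open FirstOrder.Language

variable {L : FirstOrder.Language.{u, v}} {M : Type w} [L.Structure M] {κ : Cardinal.{w}}

section Limit

/-- The elements of the tuples of the sequence with index below `t`. -/
def TupleSeq.below (I : TupleSeq M) (t : I.Idx) : Set M :=
  {x | ∃ s < t, ∃ q, I.elt s q = x}

variable (L) in
/-- The tuple `c` is a limit of the sequence `I` over `D`: over each subset of `D` over which all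
later tuples have the type of the tuple at `t`, the tuple `c` has this type too. -/
def IsLimit (I : TupleSeq M) (D : Set M) (c : Fin I.len → M) : Prop :=
  ∀ D₀ ⊆ D, ∀ t,
    (∀ t', t ≤ t' → PartialElementary L (diag D₀ ∪ {p | ∃ q, p = (I.elt t q, I.elt t' q)})) →
      PartialElementary L (diag D₀ ∪ {p | ∃ q, p = (I.elt t q, c q)})

open Filter in
-- In the ultrapower along an ultrafilter containing all final segments, the germ of the sequence
-- itself is a limit. Saturation finds a copy in `M` of its type over the small set `D`.
theorem IsSaturated.exists_isLimit (hM : IsSaturated L M κ) (hκ : ℵ₀ ≤ κ) {D : Set M}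
    (hD : #D < κ) (I : TupleSeq M) : ∃ c, IsLimit L I D c := by
  obtain hM' | hM' := isEmpty_or_nonempty M
  · exact ⟨I.elt (Classical.arbitrary _), fun _ _ _ _ =>
      partialElementary_of_subset_diag L fun p => isEmptyElim p.1⟩
  let U : Ultrafilter I.Idx := Ultrafilter.of atTop
  have hU : (U : Filter I.Idx) ≤ atTop := Ultrafilter.of_le atTop
  let N := (U : Filter I.Idx).Product fun _ => M
  let germ : (I.Idx → M) → N := fun f => (f : (U : Filter I.Idx).Product fun _ => M)
  have hgerm : ∀ {α : Type w} (φ : L.Formula α) (f : α → I.Idx → M),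
      φ.Realize (fun x => germ (f x)) ↔ ∀ᶠ t in U, φ.Realize fun x => f x t :=
    fun φ f => Ultraproduct.realize_formula_cast φ f
  let G : Set (N × M) := Set.range fun d : D => (germ fun _ => d, d.1)
  have hG : PartialElementary L G := by
    intro φ
    choose d hd using fun g : G => g.2
    have h₁ : (fun g : G => g.1.1) = fun g : G => germ fun _ => d g :=
      funext fun g => by rw [← hd g]
    have h₂ : (fun g : G => g.1.2) = fun g : G => (d g : M) := funext fun g => by rw [← hd g]
    rw [h₁, h₂, hgerm, eventually_const]
  obtain ⟨c, hc⟩ := hM.exists_union_range hκ hG (mk_range_le.trans_lt hD)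
    fun q : Fin I.len => germ fun t => I.elt t q
  refine ⟨c, fun D₀ hD₀ t ht φ => ?_⟩
  have hK : ∀ p : ↥(diag D₀ ∪ {p | ∃ q, p = (I.elt t q, c q)}), ∃ f : I.Idx → M,
      (germ f, p.1.2) ∈ G ∪ Set.range (fun q => (germ fun t => I.elt t q, c q)) ∧
      ∀ t', (p.1.1, f t') ∈ diag D₀ ∪ {p | ∃ q, p = (I.elt t q, I.elt t' q)} := by
    rintro ⟨⟨x, y⟩, ⟨h₁, h₂⟩ | ⟨q, hq⟩⟩
    · obtain rfl : x = y := h₁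
      exact ⟨fun _ => x, Or.inl ⟨⟨x, hD₀ h₂⟩, rfl⟩, fun _ => Or.inl (mem_diag h₂)⟩
    · obtain ⟨rfl, rfl⟩ := Prod.mk.inj hq
      exact ⟨fun t => I.elt t q, Or.inr ⟨q, rfl⟩, fun _ => Or.inr ⟨q, rfl⟩⟩
  choose f hf₁ hf₂ using hK
  rw [← hc.realize_iff φ hf₁, hgerm]
  have : ∀ᶠ t' in U, (φ.Realize (fun p => p.1.1) ↔ φ.Realize fun p => f p t') :=
    hU ((eventually_ge_atTop t).mono fun t' htt' =>
      (ht t' htt').realize_iff φ fun p => hf₂ p t')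
  rw [← eventually_congr this, eventually_const]

theorem Indiscernible.partialElementary_of_le {A : Set M} {I : TupleSeq M}
    (h : Indiscernible L A I) {t t' : I.Idx} (htt' : t ≤ t') :
    PartialElementary L
      (diag (A ∪ I.below t) ∪ {p | ∃ q, p = (I.elt t q, I.elt t' q)}) := by
  refine (indiscernible_iff.1 h ({p | p.1 = p.2 ∧ p.1 < t} ∪ {(t, t')}) ?_).mono ?_
  · rintro ⟨x, y⟩ (⟨h₁, h₂⟩ | hp) ⟨x', y'⟩ (⟨h₃, h₄⟩ | hq)
    · obtain rfl : x = y := h₁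
      obtain rfl : x' = y' := h₃
      exact Iff.rfl
    · obtain rfl : x = y := h₁
      obtain ⟨rfl, rfl⟩ := Prod.mk.inj hq
      exact iff_of_true h₂ (lt_of_lt_of_le h₂ htt')
    · obtain rfl : x' = y' := h₃
      obtain ⟨rfl, rfl⟩ := Prod.mk.inj hp
      exact iff_of_false h₄.not_gt (lt_of_lt_of_le h₄ htt').not_gt
    · obtain ⟨rfl, rfl⟩ := Prod.mk.inj hp
      obtain ⟨rfl, rfl⟩ := Prod.mk.inj hq
      simp
  · rintro ⟨x, y⟩ (⟨hp, hx | ⟨s, hs, q, hq⟩⟩ | ⟨q, hq⟩)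
    · exact Or.inl ⟨hp, hx⟩
    · obtain rfl : x = y := hp
      exact Or.inr ⟨(s, s), Or.inl ⟨rfl, hs⟩, q, by rw [hq]⟩
    · exact Or.inr ⟨(t, t'), Or.inr rfl, q, hq⟩

theorem IsLimit.partialElementary {A D : Set M} {I : TupleSeq M} {c : Fin I.len → M}
    (hc : IsLimit L I D c) (h : Indiscernible L A I) (hA : A ⊆ D) (hI : I.points ⊆ D)
    (t : I.Idx) :
    PartialElementary L (diag (A ∪ I.below t) ∪ {p | ∃ q, p = (I.elt t q, c q)}) :=
  hc _ (Set.union_subset hA (by rintro _ ⟨s, _, q, rfl⟩; exact hI ⟨s, q, rfl⟩)) t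
    fun _ ht' => h.partialElementary_of_le ht'

end Limit

/-! ### Adjoining limits to the base and enlarging the set of good sequences -/

variable {ι : Type*}

/-- A finite relation lies below some index `t`, where `c` is interchangeable with the tuple at `t`.
Fixing `t` as well leaves an order relation, so the original indiscernibility applies. -/
theorem JointlyIndiscernible.union_range_of_isLimit {B D : Set M} {I : ι → TupleSeq M} {i : ι}
    [NoMaxOrder (I i).Idx] (hI : JointlyIndiscernible L B I Set.univ) (hB : B ⊆ D)
    (hD : familyPoints I Set.univ ⊆ D) {c : Fin (I i).len → M} (hc : IsLimit L (I i) D c) :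
    JointlyIndiscernible L (B ∪ Set.range c) I Set.univ := by
  classical
  refine jointlyIndiscernible_of_finite fun ρ hρ hfin => ?_
  obtain ⟨t₁, ht₁⟩ := ((hfin i).image fun z => max z.1 z.2).bddAbove
  obtain ⟨t, ht⟩ := exists_gt t₁
  have hlt : ∀ z ∈ ρ i, z.1 < t ∧ z.2 < t := fun z hz =>
    max_lt_iff.1 ((ht₁ ⟨z, hz, rfl⟩).trans_lt ht)
  have h₁ : Indiscernible L (B ∪ familyPoints I (Set.univ \ {i})) (I i) :=
    jointlyIndiscernible_singleton.1 (hI.subfamily (Set.subset_univ _) subset_rfl)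
  have h₂ := hc.partialElementary h₁
    (Set.union_subset hB ((familyPoints_mono I (Set.subset_univ _)).trans hD))
    (fun x hx => hD ⟨i, trivial, hx⟩) t
  have h₃ := hI (Function.update ρ i (insert (t, t) (ρ i))) fun j => by
    obtain rfl | hj := eq_or_ne j i
    · simpa using (hρ j).insert hlt
    · simpa [hj] using hρ j
  refine h₂.conj h₃ h₂ ?_
  rintro ⟨x, y⟩ (⟨hxy, hx | ⟨q, hq⟩⟩ | ⟨j, -, z, hz, q, hp⟩)
  · exact ⟨x, x, Or.inl (mem_diag (Or.inl (Or.inl hx))), Or.inl (mem_diag hx),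
      Or.inl ⟨hxy, Or.inl (Or.inl hx)⟩⟩
  · obtain rfl : x = y := hxy
    exact ⟨_, _, Or.inr ⟨q, by rw [hq]⟩,
      Or.inr ⟨i, trivial, (t, t), by simp, q, rfl⟩, Or.inr ⟨q, by rw [hq]⟩⟩
  · obtain ⟨rfl, rfl⟩ := Prod.mk.inj hp
    obtain rfl | hj := eq_or_ne j i
    · exact ⟨_, _, Or.inl (mem_diag (Or.inr ⟨z.1, (hlt z hz).1, q, rfl⟩)),
        Or.inr ⟨j, trivial, z, by simpa using Or.inr hz, q, rfl⟩,
        Or.inl (mem_diag (Or.inr ⟨z.2, (hlt z hz).2, q, rfl⟩))⟩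
    · have hj' : j ∈ Set.univ \ {i} := ⟨trivial, hj⟩
      exact ⟨_, _, Or.inl (mem_diag (Or.inl (Or.inr (elt_mem_familyPoints I hj' _ q)))),
        Or.inr ⟨j, trivial, z, by simpa [hj] using hz, q, rfl⟩,
        Or.inl (mem_diag (Or.inl (Or.inr (elt_mem_familyPoints I hj' _ q))))⟩

theorem jointlyIndiscernible_union_iUnion {B : Set M} {I : ι → TupleSeq M} {R : Set ι}
    {J : ℕ → Set M} (hJ : Monotone J) (h : ∀ n, JointlyIndiscernible L (B ∪ J n) I R) :
    JointlyIndiscernible L (B ∪ ⋃ n, J n) I R := by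
  intro ρ hρ
  refine (PartialElementary.iUnion (G := fun n => diag (B ∪ J n) ∪ familyPairs I R ρ)
    (fun m n hmn => Set.union_subset_union_left _ (diag_mono (Set.union_subset_union_right _
      (hJ hmn)))) fun n => h n ρ hρ).mono ?_
  rintro p (⟨hp, hp' | hp'⟩ | hp)
  · exact Set.mem_iUnion.2 ⟨0, Or.inl ⟨hp, Or.inl hp'⟩⟩
  · obtain ⟨n, hn⟩ := Set.mem_iUnion.1 hp'
    exact Set.mem_iUnion.2 ⟨n, Or.inl ⟨hp, Or.inr hn⟩⟩
  · exact Set.mem_iUnion.2 ⟨0, Or.inr hp⟩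

/-- An increasing sequence of sets such that limits of `I` over `D` and any member of the sequence
are contained in a later member. -/
def ContainsLimits (L : FirstOrder.Language.{u, v}) [L.Structure M] (I : TupleSeq M) (D : Set M)
    (J : ℕ → Set M) : Prop :=
  ∀ N, ∃ n ≥ N, ∃ c, IsLimit L I (D ∪ J n) c ∧ Set.range c ⊆ J (n + 1)

theorem JointlyIndiscernible.exists_containsLimits [Finite ι] (hM : IsSaturated L M κ)
    (hκ : ℵ₀ < κ) {B D : Set M} (hD : #D < κ) {I : ι → TupleSeq M}
    [∀ i, NoMaxOrder (I i).Idx] (hI : JointlyIndiscernible L B I Set.univ) (hB : B ⊆ D)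
    (hID : familyPoints I Set.univ ⊆ D) :
    ∃ J : ℕ → Set M, Monotone J ∧ (⋃ n, J n).Countable ∧
      JointlyIndiscernible L (B ∪ ⋃ n, J n) I Set.univ ∧ ∀ i, ContainsLimits L (I i) D J := by
  obtain hι | hι := isEmpty_or_nonempty ι
  · refine ⟨fun _ => ∅, monotone_const, by simp, ?_, fun i => hι.elim i⟩
    simpa using hI
  obtain ⟨f, hf⟩ := exists_surjective_nat ι
  have hlim : ∀ (E : {E : Set M // E.Countable}) (i : ι), ∃ c, IsLimit L (I i) (D ∪ E.1) c :=
    fun E i => hM.exists_isLimit hκ.le ((mk_union_le _ _).trans_lt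
      (add_lt_of_lt hκ.le hD (((Set.countable_coe_iff.2 E.2).to_set.le_aleph0).trans_lt hκ))) _
  choose c hc using hlim
  -- Step `n` adjoins a limit of the sequence coded by the first component of `n`. Each sequence
  -- thus recurs at arbitrarily late steps, and the stages stay countable, hence small.
  let J : ℕ → {E : Set M // E.Countable} := fun n => Nat.rec ⟨∅, Set.countable_empty⟩
    (fun n E => ⟨E.1 ∪ Set.range (c E (f n.unpair.1)), E.2.union (Set.countable_range _)⟩) n
  have hJs : ∀ n, (J (n + 1)).1 = (J n).1 ∪ Set.range (c (J n) (f n.unpair.1)) := fun _ => rfl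
  have hmono : Monotone fun n => (J n).1 :=
    monotone_nat_of_le_succ fun n => by rw [hJs]; exact Set.subset_union_left
  have hJI : ∀ n, JointlyIndiscernible L (B ∪ (J n).1) I Set.univ := by
    intro n
    induction n with
    | zero => simpa [J] using hI
    | succ n ih =>
      rw [hJs, ← Set.union_assoc]
      exact ih.union_range_of_isLimit (Set.union_subset_union_left _ hB)
        (hID.trans Set.subset_union_left) (hc _ _)
  refine ⟨fun n => (J n).1, hmono, Set.countable_iUnion fun n => (J n).2,
    jointlyIndiscernible_union_iUnion hmono hJI, fun i N => ?_⟩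
  obtain ⟨l, rfl⟩ := hf i
  have hl : (Nat.pair l N).unpair.1 = l := by simp
  refine ⟨Nat.pair l N, Nat.right_le_pair l N, ?_⟩
  have := hJs (Nat.pair l N)
  rw [hl] at this
  exact ⟨_, hc (J (Nat.pair l N)) (f l), Set.subset_union_right.trans this.ge⟩

/-- The tuples are replaced from the largest index downwards: a limit has the type of the tuple at
`t` over everything below `t`, and once it lies in a stage of `J` it becomes a parameter for the
replacement of the smaller indices by later limits. -/
theorem ContainsLimits.exists_replacement {I : TupleSeq M} {C D : Set M} {J : ℕ → Set M}
    (hJ : ContainsLimits L I D J) (hmono : Monotone J) (hC : C ⊆ D) (hI : I.points ⊆ D)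
    (h : Indiscernible L (C ∪ ⋃ n, J n) I) (X : Finset I.Idx) (N : ℕ) :
    ∃ c : I.Idx → Fin I.len → M, (∀ x ∈ X, ∀ q, c x q ∈ ⋃ n, J n) ∧
      PartialElementary L (diag (C ∪ J N) ∪ {p | ∃ x ∈ X, ∃ q, p = (I.elt x q, c x q)}) := by
  classical
  induction X using Finset.induction_on_max generalizing N with
  | empty => exact ⟨I.elt, by simp, partialElementary_of_subset_diag L (by
      rintro p (hp | ⟨x, hx, -⟩)
      · exact hp.1
      · simp at hx)⟩
  | insert t X ht ih =>
    obtain ⟨n, hn, c, hc, hcJ⟩ := hJ N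
    obtain ⟨c', hc', hPE⟩ := ih (n + 1)
    have h₁ := hc.partialElementary (h.mono (Set.union_subset_union_right _
      (Set.subset_iUnion J n))) (Set.union_subset_union_left _ hC)
      (hI.trans Set.subset_union_left) t
    have hne : ∀ x ∈ X, x ≠ t := fun x hx => (ht x hx).ne
    refine ⟨Function.update c' t c, fun x hx q => ?_, h₁.comp hPE ?_⟩
    · obtain rfl | hx := Finset.mem_insert.1 hx
      · simpa using ⟨n + 1, hcJ ⟨q, rfl⟩⟩
      · simpa [hne x hx] using hc' x hx q
    · rintro ⟨x, y⟩ (⟨hxy, hx⟩ | ⟨s, hs, q, hp⟩)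
      · obtain rfl : x = y := hxy
        refine ⟨x, Or.inl (mem_diag (Or.inl ?_)), Or.inl (mem_diag ?_)⟩
        · exact Set.union_subset_union_right _ (hmono hn) hx
        · exact Set.union_subset_union_right _ (hmono (hn.trans n.le_succ)) hx
      · obtain ⟨rfl, rfl⟩ := Prod.mk.inj hp
        obtain rfl | hs := Finset.mem_insert.1 hs
        · exact ⟨c q, Or.inr ⟨q, rfl⟩,
            Or.inl ⟨by simp, Or.inr (hcJ ⟨q, rfl⟩)⟩⟩
        · exact ⟨I.elt s q, Or.inl (mem_diag (Or.inr ⟨s, ht s hs, q, rfl⟩)),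
            Or.inr ⟨s, hs, q, by simp [hne s hs]⟩⟩

/-- Over the points of `R`, the same tuples `c` from `J` stand in for both sides of a finite
relation on `I j`: for the source by replacement, for the target by indiscernibility of `I j` in
addition. With `c` as parameters, only the sequences in `R` move, which is covered by `hR`.
Parameters from `J` are treated one stage at a time because replacement respects a single stage
only. -/
theorem JointlyIndiscernible.insert_index {I : ι → TupleSeq M} {C D : Set M} {J : ℕ → Set M} {R : Set ι}
    {j : ι} (hJ : ContainsLimits L (I j) D J) (hmono : Monotone J) (hC : C ⊆ D)
    (hID : familyPoints I Set.univ ⊆ D) (hR : JointlyIndiscernible L (C ∪ ⋃ n, J n) I R)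
    (hj : Indiscernible L (C ∪ (⋃ n, J n) ∪ familyPoints I R) (I j)) :
    JointlyIndiscernible L (C ∪ ⋃ n, J n) I (insert j R) := by
  refine jointlyIndiscernible_union_iUnion hmono fun N => ?_
  · refine jointlyIndiscernible_of_finite fun ρ hρ hfin => ?_
    obtain ⟨c, hcJ, hc⟩ := hJ.exists_replacement (C := C ∪ familyPoints I R) hmono
      (Set.union_subset hC ((familyPoints_mono I (Set.subset_univ R)).trans hID))
      (fun x hx => hID ⟨j, trivial, hx⟩) (by rwa [Set.union_right_comm])
      ((hfin j).image Prod.fst).toFinset N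
    simp only [Set.Finite.mem_toFinset] at hcJ hc
    have h₁ := hc.symm (K := {p | (p.2, p.1) ∈ diag (C ∪ familyPoints I R ∪ J N) ∪
      {p | ∃ x ∈ Prod.fst '' ρ j, ∃ q, p = ((I j).elt x q, c x q)}}) fun p hp => hp
    have h₂ := h₁.comp (indiscernible_iff.1 hj (ρ j) (hρ j))
      (K := diag (C ∪ familyPoints I R ∪ J N) ∪
        {p | ∃ z ∈ ρ j, ∃ q, p = (c z.1 q, (I j).elt z.2 q)}) (by
      rintro p (⟨hp, hp'⟩ | ⟨z, hz, q, rfl⟩)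
      · refine ⟨p.1, Or.inl (mem_diag hp'), Or.inl ⟨hp, ?_⟩⟩
        rw [Set.union_right_comm]
        exact Set.union_subset_union_right _ (Set.subset_iUnion J N) hp'
      · exact ⟨_, Or.inr ⟨z.1, ⟨z, hz, rfl⟩, q, rfl⟩, Or.inr ⟨z, hz, q, rfl⟩⟩)
    refine h₁.conj (hR ρ hρ) h₂ ?_
    rintro ⟨x, y⟩ (⟨hxy, hx⟩ | ⟨i, rfl | hi, z, hz, q, hp⟩)
    · obtain rfl : x = y := hxy
      have hx' : x ∈ C ∪ familyPoints I R ∪ J N :=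
        Set.union_subset_union_left _ Set.subset_union_left hx
      exact ⟨x, x, Or.inl (mem_diag hx'),
        Or.inl (mem_diag (Set.union_subset_union_right _ (Set.subset_iUnion J N) hx)),
        Or.inl (mem_diag hx')⟩
    · obtain ⟨rfl, rfl⟩ := Prod.mk.inj hp
      exact ⟨c z.1 q, c z.1 q, Or.inr ⟨z.1, ⟨z, hz, rfl⟩, q, rfl⟩,
        Or.inl (mem_diag (Or.inr (hcJ _ ⟨z, hz, rfl⟩ q))), Or.inr ⟨z, hz, q, rfl⟩⟩
    · obtain ⟨rfl, rfl⟩ := Prod.mk.inj hp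
      exact ⟨_, _, Or.inl (mem_diag (Or.inl (Or.inr (elt_mem_familyPoints I hi z.1 q)))),
        Or.inr ⟨i, hi, z, hz, q, rfl⟩,
        Or.inl (mem_diag (Or.inl (Or.inr (elt_mem_familyPoints I hi z.2 q))))⟩

end DpRank

/-! ### The conditions `S_{k,n}` and dp-rank -/

namespace DpRank

open FirstOrder.Language

variable {L : FirstOrder.Language.{u, v}} {M : Type w} [L.Structure M] {κ : Cardinal.{w}}

theorem TupleSeq.mk_points_lt (hκ : ℵ₀ < κ) (I : TupleSeq M) (hI : #I.Idx < κ) : #I.points < κ := by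
  have : I.points ⊆ Set.range fun p : I.Idx × ULift.{w} (Fin I.len) => I.elt p.1 p.2.down := by
    rintro _ ⟨i, j, rfl⟩
    exact ⟨(i, ⟨j⟩), rfl⟩
  refine (mk_le_mk_of_subset this).trans_lt (mk_range_le.trans_lt ?_)
  rw [mk_prod, lift_id, lift_id]
  exact mul_lt_of_lt hκ.le hI (mk_lt_aleph0.trans hκ)

theorem mk_familyPoints_lt {ι : Type*} (hκ : ℵ₀ < κ) {I : ι → TupleSeq M}
    (hI : ∀ i, #(I i).Idx < κ) {R : Set ι} (hR : R.Finite) : #(familyPoints I R) < κ := by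
  induction R, hR using Set.Finite.induction_on with
  | empty =>
    have : familyPoints I ∅ = ∅ := by ext; simp [familyPoints]
    simpa [this] using aleph0_pos.trans hκ
  | @insert i R _ _ ih =>
    have : familyPoints I (insert i R) ⊆ (I i).points ∪ familyPoints I R := by
      rintro x ⟨j, rfl | hj, hx⟩
      · exact Or.inl hx
      · exact Or.inr ⟨j, hj, hx⟩
    exact (mk_le_mk_of_subset this).trans_lt ((mk_union_le _ _).trans_lt
      (add_lt_of_lt hκ.le ((I i).mk_points_lt hκ (hI i)) ih))

theorem jointlyIndiscernible_comp {ι ι' : Type*} [Finite ι'] {A : Set M} {I : ι → TupleSeq M}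
    {f : ι' → ι} (hf : f.Injective) :
    JointlyIndiscernible L A (fun i => I (f i)) Set.univ ↔
      JointlyIndiscernible L A I (Set.range f) := by
  have (j : ι') : familyPoints I (Set.range f \ {f j}) =
      familyPoints (fun i => I (f i)) (Set.univ \ {j}) := by
    ext x
    constructor
    · rintro ⟨_, ⟨⟨i, rfl⟩, hi⟩, hx⟩
      exact ⟨i, ⟨trivial, fun h => hi (congrArg f h)⟩, hx⟩
    · rintro ⟨i, ⟨-, hi⟩, hx⟩
      exact ⟨f i, ⟨⟨i, rfl⟩, fun h => hi (hf h)⟩, hx⟩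
  rw [jointlyIndiscernible_iff Set.finite_univ, jointlyIndiscernible_iff (Set.finite_range f),
    Set.forall_mem_range]
  simp only [this, Set.mem_univ, true_imp_iff]

theorem mutuallyIndiscernible_singleton {ι : Type*} {A : Set M} {I : ι → TupleSeq M} {j : ι} :
    MutuallyIndiscernible L A (fun i : ({j} : Finset ι) => I i) ↔ Indiscernible L A (I j) := by
  rw [mutuallyIndiscernible_coe_iff, Finset.coe_singleton, jointlyIndiscernible_singleton]

theorem sCond_one_iff {ι α : Type*} [Fintype ι] {A : Set M} {I : ι → TupleSeq M} {a : α → M}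
    {k : ℕ} (hk : Fintype.card ι = k + 1) :
    SCond L κ A I a k 1 ↔ ∀ B : Set M, A ⊆ B → #B < κ → MutuallyIndiscernible L B I →
      ∃ j, Indiscernible L (B ∪ Set.range a) (I j) := by
  constructor
  · intro h B hAB hB hI
    obtain ⟨R, -, hR, hRI⟩ := h.2 B hAB hB hI Finset.univ hk
    obtain ⟨j, rfl⟩ := Finset.card_eq_one.1 hR
    exact ⟨j, mutuallyIndiscernible_singleton.1 hRI⟩
  · refine fun h => ⟨hk.ge, fun B hAB hB hI T hT => ?_⟩
    obtain ⟨j, hj⟩ := h B hAB hB hI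
    rw [(Finset.card_eq_iff_eq_univ T).1 (hT.trans hk.symm)]
    exact ⟨{j}, Finset.subset_univ _, rfl, mutuallyIndiscernible_singleton.2 hj⟩

/-- For small index sets without last element, `S_{k,1}` for the subfamilies with `k + 1` members
implies `S_{k,n}`. -/
theorem sCond_of_subfamilies {ι : Type*} [Fintype ι] (hM : IsSaturated L M κ) (hκ : ℵ₀ < κ)
    {A : Set M} {r : ℕ} {a : Fin r → M} {k n : ℕ} {I : ι → TupleSeq M}
    (hmax : ∀ i, NoMaxOrder (I i).Idx) (hcard : ∀ i, #(I i).Idx < κ)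
    (hk : k + n ≤ Fintype.card ι)
    (h : ∀ T : Finset ι, T.card = k + 1 → SCond L κ A (fun i : T => I i) a k 1) :
    SCond L κ A I a k n := by
  classical
  refine ⟨hk, fun B hAB hB hI T hT => ?_⟩
  rw [mutuallyIndiscernible_iff] at hI
  have hpts := mk_familyPoints_lt hκ hcard (Set.finite_univ (α := ι))
  have ha : #(Set.range a) < κ := (Set.finite_range a).lt_aleph0.trans hκ
  -- The limits are taken over `a` too, although the family need not be indiscernible over `a`; this
  -- is what lets the replacements preserve types over `Ba`.
  let D := B ∪ Set.range a ∪ familyPoints I Set.univ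
  have hD : #D < κ := (mk_union_le _ _).trans_lt
    (add_lt_of_lt hκ.le ((mk_union_le _ _).trans_lt (add_lt_of_lt hκ.le hB ha)) hpts)
  obtain ⟨J, hmono, hJc, hJI, hJ⟩ := hI.exists_containsLimits hM hκ hD
    (Set.subset_union_left.trans Set.subset_union_left) Set.subset_union_right
  have hJκ : #↥(⋃ n, J n) < κ := (Set.Countable.le_aleph0 hJc).trans_lt hκ
  have key : ∀ l ≤ n, ∃ R ⊆ T, R.card = l ∧
      JointlyIndiscernible L (B ∪ Set.range a ∪ ⋃ n, J n) I (R : Set ι) := by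
    intro l
    induction l with
    | zero =>
      refine fun _ => ⟨∅, Finset.empty_subset _, rfl, fun ρ _ =>
        partialElementary_of_subset_diag L ?_⟩
      rintro p (hp | ⟨i, hi, -⟩)
      · exact hp.1
      · simp at hi
    | succ l ih =>
      intro hl
      obtain ⟨R, hRT, hRl, hR⟩ := ih (Nat.le_of_succ_le hl)
      -- As `l < n`, at least `k + 1` of the `k + n` sequences remain outside `R`.
      obtain ⟨T', hT', hT'k⟩ := Finset.exists_subset_card_eq (s := T \ R) (n := k + 1) (by
        rw [Finset.card_sdiff_of_subset hRT]; omega)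
      let B' := B ∪ (⋃ n, J n) ∪ familyPoints I (Set.univ \ (T' : Set ι))
      have hB' : #B' < κ := (mk_union_le _ _).trans_lt
        (add_lt_of_lt hκ.le ((mk_union_le _ _).trans_lt (add_lt_of_lt hκ.le hB hJκ))
          (mk_familyPoints_lt hκ hcard (Set.toFinite _)))
      obtain ⟨⟨j, hjT'⟩, hj⟩ := (sCond_one_iff (by simpa using hT'k)).1 (h T' hT'k) B'
        (hAB.trans (Set.subset_union_left.trans Set.subset_union_left)) hB'
        (mutuallyIndiscernible_coe_iff.2 (hJI.subfamily (Set.subset_univ _) subset_rfl))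
      obtain ⟨hjT, hjR⟩ := Finset.mem_sdiff.1 (hT' hjT')
      refine ⟨insert j R, Finset.insert_subset hjT hRT, by simp [hjR, hRl], ?_⟩
      rw [Finset.coe_insert]
      refine hR.insert_index (hJ j) hmono Set.subset_union_left Set.subset_union_right
        (hj.mono ?_)
      have hRT' : (R : Set ι) ⊆ Set.univ \ (T' : Set ι) := fun i hi =>
        ⟨trivial, fun hi' => (Finset.mem_sdiff.1 (hT' hi')).2 hi⟩
      rintro x (((hx | hx) | hx) | hx)
      · exact Or.inl (Or.inl (Or.inl hx))
      · exact Or.inr hx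
      · exact Or.inl (Or.inl (Or.inr hx))
      · exact Or.inl (Or.inr (familyPoints_mono I hRT' hx))
  obtain ⟨R, hRT, hRn, hR⟩ := key n le_rfl
  refine ⟨R, hRT, hRn, mutuallyIndiscernible_coe_iff.2 ?_⟩
  exact hR.subfamily subset_rfl (Set.subset_union_left.trans Set.subset_union_left)

/-- `S_{k,1}` for all families implies `S_{k,n}` for all families. -/
theorem sCond_of_forall_sCond_one (hM : IsSaturated L M κ) (hκ : ℵ₀ < κ)
    {A : Set M} {r : ℕ} {a : Fin r → M} {k : ℕ}
    (h : ∀ (m : ℕ) (I : Fin m → TupleSeq M), k < m → MutuallyIndiscernible L A I →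
        SCond L κ A I a k 1) {n m : ℕ} {I : Fin m → TupleSeq M} (hk : k + n ≤ m) :
    SCond L κ A I a k n := by
  refine ⟨by simpa using hk, fun B hAB hB hI T hT => ?_⟩
  -- The replacement depends on `B`, which is harmless since the hypothesis covers all families
  -- mutually indiscernible over `A`.
  obtain ⟨I', hmax, hcard, hI', hR⟩ := (mutuallyIndiscernible_iff.1 hI).exists_nat_family hM hκ hB
    (B ∪ Set.range a)
  have hS : SCond L κ A I' a k n := by
    refine sCond_of_subfamilies hM hκ hmax hcard (by simpa using hk) fun T hT => ?_
    have hf := (T.orderEmbOfFin hT).injective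
    have hJ := fun (B : Set M) => (jointlyIndiscernible_comp (L := L) (A := B) (I := I') hf)
    simp only [Finset.range_orderEmbOfFin] at hJ
    rw [sCond_one_iff (by simpa using hT)]
    intro B' hAB' hB' hB'I
    obtain ⟨j, hj⟩ := (sCond_one_iff (by simp)).1 (h (k + 1) (fun i => I' (T.orderEmbOfFin hT i))
      k.lt_succ_self (mutuallyIndiscernible_iff.2 ((hJ A).2 (hI'.subfamily (Set.subset_univ _)
        (hAB.trans Set.subset_union_left))))) B' hAB' hB'
      (mutuallyIndiscernible_iff.2 ((hJ B').2 (mutuallyIndiscernible_coe_iff.1 hB'I)))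
    exact ⟨⟨_, T.orderEmbOfFin_mem hT j⟩, hj⟩
  obtain ⟨R, hRT, hRn, hRI⟩ := hS.2 B hAB hB (mutuallyIndiscernible_iff.2 hI') T hT
  exact ⟨R, hRT, hRn, mutuallyIndiscernible_coe_iff.2
    (hR _ (mutuallyIndiscernible_coe_iff.1 hRI))⟩

/-- Among `1 + k` sequences that are mutually indiscernible over a set `B` containing `A`, at least
one is indiscernible over `B` and a given realization of a type over `A` of dp-rank at most `k`. -/
theorem DpRankLE.exists_indiscernible {A B : Set M} (hAB : A ⊆ B) {α : Type*}
    {p : Set (L[[A]].Formula α)} {k : ℕ} (hp : DpRankLE L p k) {c : α → M} (hc : Realizes L c p)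
    {I : Fin (1 + k) → TupleSeq M} (hI : JointlyIndiscernible L B I Set.univ) :
    ∃ j, Indiscernible L (B ∪ Set.range c) (I j) := by
  -- Each failure of indiscernibility is witnessed by a relation `ρ` and finitely many parameters
  -- `b` from `B`. Nonemptiness of `ρ` ensures that the constant coordinates `b` occur among the
  -- pairs of the extended sequence.
  have hbad : ∀ j, ∃ (l : ℕ) (b : Fin l → M) (ρ : Set ((I j).Idx × (I j).Idx)),
      Set.range b ⊆ B ∧ OrderRel ρ ∧ ρ.Nonempty ∧
        (PartialElementary L (diag (Set.range b ∪ Set.range c) ∪ (I j).pairs ρ) →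
          Indiscernible L (B ∪ Set.range c) (I j)) := by
    intro j
    by_cases hj : Indiscernible L (B ∪ Set.range c) (I j)
    · obtain ⟨x⟩ := (inferInstance : Nonempty (I j).Idx)
      exact ⟨0, Fin.elim0, {(x, x)}, by simp, orderRel_of_eq (by simp), Set.singleton_nonempty _,
        fun _ => hj⟩
    · have hj' := hj
      rw [indiscernible_iff] at hj'
      push Not at hj'
      obtain ⟨ρ, hρ, hn⟩ := hj'
      obtain ⟨F, hF, hfin, hFn⟩ : ∃ F ⊆ diag (B ∪ Set.range c) ∪ (I j).pairs ρ, F.Finite ∧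
          ¬ PartialElementary L F := by
        by_contra! h
        exact hn (PartialElementary.of_finite h)
      obtain ⟨l, b, -, hb⟩ := ((hfin.image Prod.fst).inter_of_left B).fin_param
      refine ⟨l, b, ρ, hb.trans_subset Set.inter_subset_right, hρ, ?_,
        fun h => (hFn (h.mono ?_)).elim⟩
      · rw [Set.nonempty_iff_ne_empty]
        rintro rfl
        refine hn (partialElementary_of_subset_diag L ?_)
        rintro q (hq | ⟨z, hz, -⟩)
        · exact hq.1
        · exact hz.elim
      · intro q hq
        obtain ⟨h₁, h₂ | h₂⟩ | h₁ := hF hq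
        · exact Or.inl ⟨h₁, Or.inl (hb.ge ⟨⟨q, hq, rfl⟩, h₂⟩)⟩
        · exact Or.inl ⟨h₁, Or.inr h₂⟩
        · exact Or.inr h₁
  choose l b ρ hb hρ hne hρI using hbad
  let I' : Fin (1 + k) → TupleSeq M := fun j =>
    { Idx := (I j).Idx, len := (I j).len + l j, elt := fun x => Fin.append ((I j).elt x) (b j) }
  have hI' : JointlyIndiscernible L A I' Set.univ := by
    refine fun σ hσ => (hI σ hσ).mono ?_
    rintro q (hq | ⟨j, hj, z, hz, x, rfl⟩)
    · exact Or.inl (diag_mono hAB hq)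
    · refine Fin.addCases (fun x => ?_) (fun x => ?_) x
      · exact Or.inr ⟨j, hj, z, hz, x, by simp [I']⟩
      · exact Or.inl (by simpa [I'] using mem_diag (hb j ⟨x, rfl⟩))
  obtain ⟨j, hj⟩ := hp c hc I' (mutuallyIndiscernible_iff.2 hI')
  refine ⟨j, hρI j ((indiscernible_iff.1 hj (ρ j) (hρ j)).mono ?_)⟩
  rintro ⟨x, y⟩ (⟨hxy, ⟨q, hq⟩ | hx⟩ | ⟨z, hz, q, hq⟩)
  · obtain rfl : x = y := hxy
    obtain ⟨z, hz⟩ := hne j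
    exact Or.inr ⟨z, hz, Fin.natAdd _ q, by simpa [I'] using hq.symm⟩
  · exact Or.inl ⟨hxy, Or.inr hx⟩
  · exact Or.inr ⟨z, hz, Fin.castAdd _ q, by simpa [I'] using hq⟩

theorem DpRankLE.sCond_one {A : Set M} {α : Type*} {p : Set (L[[A]].Formula α)} {k : ℕ}
    (hp : DpRankLE L p k) {c : α → M} (hc : Realizes L c p) {m : ℕ} {I : Fin m → TupleSeq M}
    (hk : k < m) : SCond L κ A I c k 1 := by
  refine ⟨by simpa using hk, fun B hAB _ hI T hT => ?_⟩
  rw [add_comm] at hT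
  have hJ := jointlyIndiscernible_comp (L := L) (A := B) (I := I) (T.orderEmbOfFin hT).injective
  rw [Finset.range_orderEmbOfFin] at hJ
  obtain ⟨j, hj⟩ := hp.exists_indiscernible hAB hc
    (hJ.2 ((mutuallyIndiscernible_iff.1 hI).subfamily (Set.subset_univ _) Set.subset_union_left))
  exact ⟨{T.orderEmbOfFin hT j}, Finset.singleton_subset_iff.2 (T.orderEmbOfFin_mem hT j), rfl,
    mutuallyIndiscernible_singleton.2 hj⟩

theorem realizes_tp (A : Set M) {α : Type*} (a : α → M) : Realizes L a (tp L A a) := fun _ h => h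

end DpRank

open DpRank in
theorem mainTheorem2 (L : FirstOrder.Language.{u, v}) (M : Type w) [L.Structure M]
    (κ : Cardinal.{w}) (hκ : ℵ₀ < κ) (hM : IsSaturated L M κ)
    (A : Set M) (hA : #A < κ) (r : ℕ) (a : Fin r → M) (k : ℕ) :
    -- dp-rank at most `k` leaves `m - k` of `m` sequences mutually indiscernible
    (DpRankLE L (tp L A a) k →
      ∀ B : Set M, A ⊆ B → #B < κ →
        ∀ (m : ℕ) (I : Fin m → TupleSeq M), k < m → MutuallyIndiscernible L B I →
          ∃ R : Finset (Fin m), R.card = m - k ∧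
            MutuallyIndiscernible L (B ∪ Set.range a) (fun i : R => I i)) ∧
    -- dp-rank at most `k` in terms of `S_{k,1}`
    (DpRankLE L (tp L A a) k ↔
      ∀ c : Fin r → M, Realizes L c (tp L A a) →
        ∀ (m : ℕ) (I : Fin m → TupleSeq M), k < m → MutuallyIndiscernible L A I →
          SCond L κ A I c k 1) ∧
    -- `S_{k,1}` for all families implies `S_{k,n}` for all families
    ((∀ (m : ℕ) (I : Fin m → TupleSeq M), k < m → MutuallyIndiscernible L A I →
        SCond L κ A I a k 1) →
      ∀ (n m : ℕ) (I : Fin m → TupleSeq M), k + n ≤ m → MutuallyIndiscernible L A I →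
        SCond L κ A I a k n) ∧
    -- for one family (small index sets without last element):
    -- `S_{k,1}` for its subfamilies with `k + 1` members implies `S_{k,n}`
    (∀ (n m : ℕ) (I : Fin m → TupleSeq M),
      (∀ i, NoMaxOrder (I i).Idx) → (∀ i, #(I i).Idx < κ) →
      k + n ≤ m → MutuallyIndiscernible L A I →
      (∀ T : Finset (Fin m), T.card = k + 1 → SCond L κ A (fun i : T => I i) a k 1) →
      SCond L κ A I a k n) := by
  have h₃ := fun h n m (I : Fin m → TupleSeq M) (hk : k + n ≤ m) =>
    sCond_of_forall_sCond_one (A := A) (a := a) (n := n) (I := I) hM hκ h hk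
  refine ⟨fun hp B hAB hB m I hk hI => ?_, ⟨fun hp c hc m I hk _ => hp.sCond_one hc hk,
    fun h c hc I hI => ?_⟩, fun h n m I hk _ => h₃ h n m I hk,
    fun n m I hmax hcard hk _ h => sCond_of_subfamilies hM hκ hmax hcard (by simpa using hk) h⟩
  -- With `n = m - k`, the whole family is the only subfamily of `k + n` sequences.
  · have hS := h₃ (fun m I hk _ => hp.sCond_one (realizes_tp A a) hk) (m - k) m I (by omega)
    obtain ⟨R, -, hR, hRI⟩ := hS.2 B hAB hB hI Finset.univ (by simp; omega)
    exact ⟨R, hR, hRI⟩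
  · exact (sCond_one_iff (by simp [add_comm])).1 (h c hc (1 + k) I (by omega) hI) A subset_rfl hA hI
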